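/- Let $l\ge 1$, $\mathfrak g=\mathfrak{sl}(l+1)$ with simple roots $\alpha_1,\dots,\alpha_l$, positive roots $\Delta_+$, fundamental weights $\lambda_1,\dots,\lambda_l$, root lattice $Q$, weight lattice $P$ and form $\langle\cdot,\cdot\rangle$ normalized by $\langle\alpha_i,\alpha_i\rangle=2$. Let $\epsilon:P\times P\to\mathbb C^\times$ be a $2$-cocycle with $\epsilon(\alpha,\beta)\epsilon(\beta,\alpha)^{-1}=(-1)^{\langle\alpha,\beta\rangle}$ for $\alpha,\beta\in Q$. Let $V_P=M(1)\otimes\mathbb C[P]$, where $M(1)=S(\mathfrak h\otimes t^{-1}\mathbb C[t^{-1}])$ is the Heisenberg module of level one, and for $\alpha\in\Delta_+$, $m\in\mathbb Z$ let $x_\alpha(m)$ be the coefficient of $x^{-m-1}$ in $$Y(e^\alpha,x)=\exp\Big(\sum_{n\ge1}\frac{\alpha(-n)}{n}x^{n}\Big)\exp\Big(-\sum_{n\ge1}\frac{\alpha(n)}{n}x^{-n}\Big)\,\epsilon_\alpha e^{\alpha}x^{\alpha},\qquad \epsilon_\alpha e^\alpha x^\alpha(v\otimes e^\beta)=\epsilon(\alpha,\beta)x^{\langle\alpha,\beta\rangle}v\otimes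 e^{\alpha+\beta}.$$ Let $\bar{\mathfrak n}=\mathfrak n\otimes\mathbb C[t,t^{-1}]$, with $\mathfrak n=\sum_{\alpha\in\Delta_+}\mathbb Cx_\alpha$, act on $V_P$ through the operators $x_\alpha(m)$, and let $W(\Lambda_0)=U(\bar{\mathfrak n})\cdot 1$ and $W(\Lambda_j)=U(\bar{\mathfrak n})\cdot e^{\lambda_j}$ ($1\le j\le l$) be the principal subspaces. Let $V_P$ be graded by weight, i.e. by the eigenvalues of $L(0)$ (so that $h(-n)$ has weight $n$ and $e^\lambda$ has weight $\frac12\langle\lambda,\lambda\rangle$), and by the charges, the eigenvalues of $\lambda_1(0),\dots,\lambda_l(0)$; write $W(\Lambda_i)_{r_1,\dots,r_l;k}$ for the subspace of $W(\Lambda_i)$ of charges $r_1,\dots,r_l\in\mathbb{Q}$ and weight $k\in\mathbb{Q}$. Then for every $j=1,\dots,l$: (1) The operator $e^{\lambda_j}:v\otimes e^\beta\mapsto v\otimes e^{\lambda_j+\beta}$ on $V_P$ restricts to a linear isomorphism $W(\Lambda_0)\to W(\Lambda_j)$, and for all $r_1,\dots,r_l,k\in\mathbb Q$ it maps $W(\Lambda_0)_{r_1,\dots,r_l;k}$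 onto $$W(\Lambda_j)_{r_1+\langle\lambda_1,\lambda_j\rangle,\dots,r_l+\langle\lambda_l,\lambda_j\rangle;\;k+r_j+\frac12\langle\lambda_j,\lambda_j\rangle}.$$ (2) $W(\Lambda_0)$ and $W(\Lambda_j)$ are the sums of their homogeneous subspaces, which are finite-dimensional, so that the graded dimensions $\chi_i(x_1,\dots,x_l;q)=\sum_{r,k}\dim W(\Lambda_i)_{r_1,\dots,r_l;k}\,x_1^{r_1}\cdots x_l^{r_l}q^k$ ($i=0,j$) are well defined. Moreover $\chi_0\in\mathbb C[[x_1,\dots,x_l,q]]$, and the normalized graded dimension $$\chi_j'(x_1,\dots,x_l;q)=x_1^{-\langle\lambda_1,\lambda_j\rangle}\cdots x_l^{-\langle\lambda_l,\lambda_j\rangle}q^{-\frac12\langle\lambda_j,\lambda_j\rangle}\chi_j(x_1,\dots,x_l;q)$$ also lies in $\mathbb C[[x_1,\dots,x_l,q]]$ and satisfies $$\chi_j'(x_1,\dots,x_l;q)=\chi_0(x_1,\dots,x_{j-1},x_jq,x_{j+1},\dots,x_l;q).$$ -/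

import Mathlib

open scoped Nat

noncomputable section

namespace PrincipalSubspace

/-! ## The weight lattice of `sl(l+1)` -/

/-- The weight lattice `P`, in coordinates with respect to the fundamental weights:
`a : Weight l` is the weight `∑ i, a i • λ_i`.  The index `i : Fin l` stands for the node
`i + 1` of the Dynkin diagram of type `A_l`. -/
abbrev Weight (l : ℕ) : Type := Fin l → ℤ

variable {l : ℕ}

/-- The fundamental weight `λ_i`. -/
def fundWeight (i : Fin l) : Weight l := Pi.single i 1

/-- The fundamental weight `λ_i`, identified by the trace form with a traceless diagonal matrix of
size `l + 1` (given by its diagonal): `λ_i = ∑_{k ≤ i} E_kk - (i + 1) / (l + 1) * I`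
for `i` counted from `0`. -/
def fundDiag (i : Fin l) (k : Fin (l + 1)) : ℚ :=
  (if (k : ℕ) ≤ (i : ℕ) then 1 else 0) - ((i : ℚ) + 1) / ((l : ℚ) + 1)

/-- The traceless diagonal matrix of a weight. -/
def toDiag (a : Weight l) (k : Fin (l + 1)) : ℚ := ∑ i, (a i : ℚ) * fundDiag i k

/-- The form `⟨a, b⟩` on the weight lattice: the trace form of the diagonal matrices, normalized
by `⟨α, α⟩ = 2` for every root `α`. -/
def form (a b : Weight l) : ℚ := ∑ k, toDiag a k * toDiag b k

/-- The simple root `α_i`, whose coordinates are the entries of row `i` of the Cartan matrix: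
`α_i = 2 λ_i - λ_{i-1} - λ_{i+1}` (with the terms that do not exist omitted). -/
def simpleRoot (i : Fin l) : Weight l := fun j =>
  if i = j then 2 else if (i : ℕ) + 1 = j ∨ (j : ℕ) + 1 = i then -1 else 0

/-- The set `Δ₊` of the positive roots `α_i + α_{i+1} + ⋯ + α_j`, `i ≤ j`, of `sl(l+1)`. -/
def positiveRoots (l : ℕ) : Set (Weight l) :=
  {a | ∃ i j : Fin l, i ≤ j ∧ a = ∑ k ∈ Finset.Icc i j, simpleRoot k}

/-- The root lattice `Q`. -/
def rootLattice (l : ℕ) : AddSubgroup (Weight l) := AddSubgroup.closure (Set.range simpleRoot)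

/-- A 2-cocycle `ε` on `P` with values in `ℂˣ` (in particular in a group of roots of unity) such
that `ε(α, β) ε(β, α)⁻¹ = (-1)^⟨α, β⟩` on the root lattice. -/
structure Cocycle (l : ℕ) where
  /-- the function `ε` -/
  toFun : Weight l → Weight l → ℂˣ
  cocycle : ∀ a b c, toFun a b * toFun (a + b) c = toFun b c * toFun a (b + c)
  commutator : ∀ a ∈ rootLattice l, ∀ b ∈ rootLattice l, ∀ n : ℤ, form a b = n →
    toFun a b * (toFun b a)⁻¹ = (-1) ^ n

/-! ## The Heisenberg module `M(1)` and the space `V_P` -/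

/-- `M(1) = S(𝔥 ⊗ t⁻¹ℂ[t⁻¹])`: the polynomial algebra in the elements `α_i(-n-1)`, `n : ℕ`,
the variable `(i, n)` being `α_i(-n-1)`. -/
abbrev FockSpace (l : ℕ) : Type := MvPolynomial (Fin l × ℕ) ℂ

/-- The operator `h(n)` on `M(1)`, for `h` in the weight lattice, which spans `𝔥`, and `n : ℤ`.
As `h = ∑ i, ⟨h, λ_i⟩ α_i`, for `n < 0` it is multiplication by `∑ i, ⟨h, λ_i⟩ α_i(n)`;
for `n > 0` it is the derivation with `α_i(-m) ↦ n ⟨h, α_i⟩ δ_{m,n}`; and `h(0) = 0`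
on `M(1)`. -/
def heis (h : Weight l) : ℤ → Module.End ℂ (FockSpace l)
  | Int.negSucc n =>
      LinearMap.mulLeft ℂ (∑ i, ((form h (fundWeight i) : ℚ) : ℂ) • MvPolynomial.X (i, n))
  | Int.ofNat 0 => 0
  | Int.ofNat (n + 1) =>
      ∑ i, (((n : ℂ) + 1) * ((form h (simpleRoot i) : ℚ) : ℂ)) •
        (MvPolynomial.pderiv (R := ℂ) (i, n)).toLinearMap

/-- `V_P = M(1) ⊗ ℂ[P]`; the vector `v ⊗ e^μ` is `Finsupp.single μ v`. -/
abbrev LatticeSpace (l : ℕ) : Type := Weight l →₀ FockSpace l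

/-- The vector `e^μ = 1 ⊗ e^μ` of `V_P`. -/
def latticeVec (μ : Weight l) : LatticeSpace l := Finsupp.single μ 1

/-- The operator `e^μ` on `V_P`: `v ⊗ e^β ↦ v ⊗ e^(μ+β)`. -/
def latticeOp (μ : Weight l) : Module.End ℂ (LatticeSpace l) :=
  Finsupp.lsum ℂ fun β => Finsupp.lsingle (μ + β)

/-- The operator `μ(0)` on `V_P`: `v ⊗ e^β ↦ ⟨μ, β⟩ v ⊗ e^β`. -/
def zeroMode (μ : Weight l) : Module.End ℂ (LatticeSpace l) :=
  Finsupp.lsum ℂ fun β => ((form μ β : ℚ) : ℂ) • Finsupp.lsingle β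

/-- The derivation of `M(1)` that multiplies `α_i(-n)` by `n`. -/
def degreeDer (l : ℕ) : Derivation ℂ (FockSpace l) (FockSpace l) :=
  MvPolynomial.mkDerivation ℂ fun v => ((v.2 : ℂ) + 1) • MvPolynomial.X v

/-- The operator `L(0)` on `V_P`, for which `h(-n)` has weight `n` and `e^β` has weight
`⟨β, β⟩ / 2`.  (It is `½ ∑ i, α_i(0) λ_i(0) + ∑_{n ≥ 1} ∑ i, α_i(-n) λ_i(n)`.) -/
def virasoroZero (l : ℕ) : Module.End ℂ (LatticeSpace l) :=
  Finsupp.lsum ℂ fun β => Finsupp.lsingle β ∘ₗ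
    ((degreeDer l).toLinearMap + ((form β β / 2 : ℚ) : ℂ) • LinearMap.id)

/-! ## Vertex operators -/

/-- The coefficient of `X ^ n` in `exp f = ∑ k, f ^ k / k!`, for a power series `f` with zero
constant term over a `ℂ`-algebra (so that only `k ≤ n` contribute). -/
def expCoeff {R : Type*} [Ring R] [Algebra ℂ R] (f : PowerSeries R) (n : ℕ) : R :=
  ∑ k ∈ Finset.range (n + 1), ((k ! : ℂ)⁻¹) • PowerSeries.coeff n (f ^ k)

/-- The exponent `∑_{n ≥ 1} -μ(n)/n x^{-n}` of `E⁺(-μ, x)`, as a power series in `x⁻¹`. -/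
def plusExponent (μ : Weight l) : PowerSeries (Module.End ℂ (FockSpace l)) :=
  PowerSeries.mk fun n => (-(1 / (n : ℂ))) • heis μ n

/-- The exponent `∑_{n ≥ 1} μ(-n)/n x^n` of `E⁻(-μ, x)`, as a power series in `x`. -/
def minusExponent (μ : Weight l) : PowerSeries (Module.End ℂ (FockSpace l)) :=
  PowerSeries.mk fun n => (1 / (n : ℂ)) • heis μ (-n)

/-- The coefficient of `x^{-b}` in `E⁺(-μ, x)`. -/
def Eplus (μ : Weight l) (b : ℕ) : Module.End ℂ (FockSpace l) := expCoeff (plusExponent μ) b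

/-- The coefficient of `x^a` in `E⁻(-μ, x)`. -/
def Eminus (μ : Weight l) (a : ℕ) : Module.End ℂ (FockSpace l) := expCoeff (minusExponent μ) a

/-- The weight of a monomial of `M(1)`, each `α_i(-n)` having weight `n`. -/
def monWeight (s : Fin l × ℕ →₀ ℕ) : ℤ := s.sum fun v e => (e : ℤ) * ((v.2 : ℤ) + 1)

/-- The span of the monomials of weight at most `d`. -/
def weightLE (l : ℕ) (d : ℤ) : Submodule ℂ (FockSpace l) :=
  Submodule.span ℂ {p | ∃ s : Fin l × ℕ →₀ ℕ, monWeight s ≤ d ∧ p = MvPolynomial.monomial s 1}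

theorem monWeight_nonneg (s : Fin l × ℕ →₀ ℕ) : 0 ≤ monWeight s :=
  Finset.sum_nonneg fun _ _ => by positivity

theorem monWeight_add (s t : Fin l × ℕ →₀ ℕ) : monWeight (s + t) = monWeight s + monWeight t := by
  unfold monWeight
  exact Finsupp.sum_add_index' (by simp) (by intros; push_cast; ring)

theorem monWeight_single (v : Fin l × ℕ) : monWeight (Finsupp.single v 1) = (v.2 : ℤ) + 1 := by
  simp [monWeight]

theorem weightLE_neg {d : ℤ} (hd : d < 0) {p : FockSpace l} (hp : p ∈ weightLE l d) : p = 0 := by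
  have h : {p : FockSpace l | ∃ s : Fin l × ℕ →₀ ℕ, monWeight s ≤ d ∧
      p = MvPolynomial.monomial s 1} = ∅ := by
    ext q
    simp only [Set.mem_ofPred_eq, Set.mem_empty_iff_false, iff_false, not_exists, not_and]
    intro s hs
    have := monWeight_nonneg s
    omega
  simpa [weightLE, h] using hp

theorem exists_weightLE (p : FockSpace l) : ∃ d : ℕ, p ∈ weightLE l d := by
  have mono : ∀ {d e : ℤ}, d ≤ e → weightLE l d ≤ weightLE l e := by
    intro d e h
    exact Submodule.span_mono fun q ⟨s, hs, hq⟩ => ⟨s, hs.trans h, hq⟩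
  induction p using MvPolynomial.induction_on' with
  | monomial s c =>
    refine ⟨(monWeight s).toNat, ?_⟩
    have : MvPolynomial.monomial s c = c • (MvPolynomial.monomial s 1 : FockSpace l) := by
      rw [MvPolynomial.smul_monomial, smul_eq_mul, mul_one]
    rw [this]
    exact Submodule.smul_mem _ _ (Submodule.subset_span ⟨s, Int.self_le_toNat _, rfl⟩)
  | add p q hp hq =>
    obtain ⟨d, hd⟩ := hp
    obtain ⟨e, he⟩ := hq
    exact ⟨d + e, Submodule.add_mem _ (mono (by push_cast; omega) hd)
      (mono (by push_cast; omega) he)⟩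

theorem heis_weightLE (μ : Weight l) (n : ℕ) {d : ℤ} {p : FockSpace l} (hp : p ∈ weightLE l d) :
    heis μ n p ∈ weightLE l (d - n) := by
  rcases n with _ | n
  · have : heis μ ((0 : ℕ) : ℤ) = 0 := rfl
    rw [this]
    exact Submodule.zero_mem _
  · have : heis μ ((n + 1 : ℕ) : ℤ) =
        ∑ i, (((n : ℂ) + 1) * ((form μ (simpleRoot i) : ℚ) : ℂ)) •
          (MvPolynomial.pderiv (R := ℂ) (i, n)).toLinearMap := rfl
    rw [this, LinearMap.sum_apply]
    refine Submodule.sum_mem _ fun i _ => ?_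
    rw [LinearMap.smul_apply]
    refine Submodule.smul_mem _ _ ?_
    suffices h : weightLE l d ≤ (weightLE l (d - (n + 1 : ℕ))).comap
        (MvPolynomial.pderiv (R := ℂ) (i, n)).toLinearMap from h hp
    refine Submodule.span_le.2 ?_
    rintro q ⟨s, hs, rfl⟩
    change MvPolynomial.pderiv (i, n) (MvPolynomial.monomial s (1 : ℂ)) ∈
      weightLE l (d - (n + 1 : ℕ))
    rw [MvPolynomial.pderiv_monomial]
    by_cases h0 : s (i, n) = 0
    · simp [h0]
    · have h1 : MvPolynomial.monomial (s - Finsupp.single (i, n) 1) (1 * (s (i, n) : ℂ)) =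
          (s (i, n) : ℂ) •
            (MvPolynomial.monomial (s - Finsupp.single (i, n) 1) 1 : FockSpace l) := by
        rw [MvPolynomial.smul_monomial, smul_eq_mul, mul_one, one_mul]
      rw [h1]
      refine Submodule.smul_mem _ _ (Submodule.subset_span ⟨_, ?_, rfl⟩)
      have h2 : Finsupp.single (i, n) 1 ≤ s := by
        rw [Finsupp.single_le_iff]; omega
      have h3 := monWeight_add (s - Finsupp.single (i, n) 1) (Finsupp.single (i, n) 1)
      rw [tsub_add_cancel_of_le h2, monWeight_single] at h3
      push_cast
      simp only at h3
      omega

theorem coeff_pow_weightLE (μ : Weight l) (k : ℕ) : ∀ (b : ℕ) {d : ℤ} {p : FockSpace l},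
    p ∈ weightLE l d → PowerSeries.coeff b (plusExponent μ ^ k) p ∈ weightLE l (d - b) := by
  induction k with
  | zero =>
    intro b d p hp
    rw [pow_zero, PowerSeries.coeff_one]
    split_ifs with h
    · subst h; simpa using hp
    · exact Submodule.zero_mem _
  | succ k ih =>
    intro b d p hp
    rw [pow_succ, PowerSeries.coeff_mul, LinearMap.sum_apply]
    refine Submodule.sum_mem _ fun c hc => ?_
    rw [Module.End.mul_apply, plusExponent, PowerSeries.coeff_mk, ← plusExponent,
      LinearMap.smul_apply, map_smul]
    refine Submodule.smul_mem _ _ ?_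
    have h1 := ih c.1 (heis_weightLE μ c.2 hp)
    have h2 : d - (c.2 : ℤ) - (c.1 : ℤ) = d - (b : ℤ) := by
      have := Finset.HasAntidiagonal.mem_antidiagonal.1 hc
      omega
    rwa [h2] at h1

/-- `E⁺(-μ, x) p` has finitely many terms. -/
theorem Eplus_eventually_zero (μ : Weight l) (p : FockSpace l) :
    ∃ N : ℕ, ∀ b, N < b → Eplus μ b p = 0 := by
  obtain ⟨d, hd⟩ := exists_weightLE p
  refine ⟨d, fun b hb => ?_⟩
  rw [Eplus, expCoeff, LinearMap.sum_apply]
  refine Finset.sum_eq_zero fun k _ => ?_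
  rw [LinearMap.smul_apply, weightLE_neg (by omega) (coeff_pow_weightLE μ k b hd), smul_zero]

theorem vertexPart_finite (μ : Weight l) (t : ℚ) (p : FockSpace l) :
    (Function.support fun c : {c : ℕ × ℕ // (c.1 : ℚ) - c.2 = t} =>
      Eminus μ c.1.1 (Eplus μ c.1.2 p)).Finite := by
  obtain ⟨N, hN⟩ := Eplus_eventually_zero μ p
  refine Set.Finite.of_finite_image (f := fun c => c.1.2)
    ((Set.finite_Iic N).subset ?_) ?_
  · rintro _ ⟨c, hc, rfl⟩
    by_contra h
    exact hc (by simp [hN c.1.2 (not_le.1 h)])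
  · rintro ⟨⟨a, b⟩, h⟩ _ ⟨⟨a', b'⟩, h'⟩ _ hb
    simp only at h h' hb
    subst hb
    have : (a : ℚ) = a' := by linarith
    simpa using this

/-- The coefficient of `x^t` in `E⁻(-μ, x) E⁺(-μ, x)`, an operator on `M(1)`. -/
def vertexPart (μ : Weight l) (t : ℚ) : Module.End ℂ (FockSpace l) where
  toFun p := ∑ᶠ c : {c : ℕ × ℕ // (c.1 : ℚ) - c.2 = t}, Eminus μ c.1.1 (Eplus μ c.1.2 p)
  map_add' p q := by
    simp only [map_add]
    exact finsum_add_distrib (vertexPart_finite μ t p) (vertexPart_finite μ t q)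
  map_smul' r p := by
    simp only [map_smul, RingHom.id_apply]
    exact (smul_finsum r _).symm

/-- The coefficient of `x^s`, `s ∈ ℚ`, in
`Y(e^μ, x) = E⁻(-μ, x) E⁺(-μ, x) ε_μ e^μ x^μ`, where
`ε_μ e^μ x^μ (v ⊗ e^β) = ε(μ, β) x^⟨μ, β⟩ v ⊗ e^(μ+β)`. -/
def vertexCoeff (ε : Cocycle l) (μ : Weight l) (s : ℚ) : Module.End ℂ (LatticeSpace l) :=
  Finsupp.lsum ℂ fun β => (ε.toFun μ β : ℂ) •
    (Finsupp.lsingle (μ + β) ∘ₗ vertexPart μ (s - form μ β))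

/-- The operator `x_α(m)` on `V_P`, the coefficient of `x^(-m-1)` in `Y(e^α, x)`. -/
def rootMode (ε : Cocycle l) (α : Weight l) (m : ℤ) : Module.End ℂ (LatticeSpace l) :=
  vertexCoeff ε α (-m - 1)

/-! ## Principal subspaces and their graded dimensions -/

/-- The image of `U(𝔫 ⊗ ℂ[t, t⁻¹])` in `End V_P`: the unital subalgebra generated by the action
`x_α(m)` of the elements `x_α ⊗ t^m`, `α` a positive root, `m ∈ ℤ`, which span
`𝔫 ⊗ ℂ[t, t⁻¹]`. -/
def nilpotentAlgebra (ε : Cocycle l) : Subalgebra ℂ (Module.End ℂ (LatticeSpace l)) :=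
  Algebra.adjoin ℂ {T | ∃ α ∈ positiveRoots l, ∃ m : ℤ, T = rootMode ε α m}

/-- The space `U(𝔫 ⊗ ℂ[t, t⁻¹]) · e^μ`.  For `μ = 0` it is the principal subspace `W(Λ_0)`, for
`μ = λ_j` it is `W(Λ_j)`. -/
def principalSubspace (ε : Cocycle l) (μ : Weight l) : Submodule ℂ (LatticeSpace l) :=
  (Subalgebra.toSubmodule (nilpotentAlgebra ε)).map (LinearMap.applyₗ (latticeVec μ))

/-- The homogeneous subspace of `V_P` of charge `r i` with respect to `λ_i`, for every `i`, and of
weight `k`: the joint eigenspace of the operators `λ_i(0)` and `L(0)`. -/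
def homogeneous (r : Fin l → ℚ) (k : ℚ) : Submodule ℂ (LatticeSpace l) :=
  (⨅ i, (zeroMode (fundWeight i)).eigenspace ((r i : ℚ) : ℂ)) ⊓
    (virasoroZero l).eigenspace ((k : ℚ) : ℂ)

/-- The homogeneous subspaces of `U(𝔫 ⊗ ℂ[t, t⁻¹]) · e^μ`. -/
def homPart (ε : Cocycle l) (μ : Weight l) (r : Fin l → ℚ) (k : ℚ) :
    Submodule ℂ (LatticeSpace l) :=
  principalSubspace ε μ ⊓ homogeneous r k

/-- Formal series `∑ c(r, k) x₁^(r 1) ⋯ x_l^(r l) q^k` with complex coefficients and with arbitrary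
rational exponents. -/
abbrev FormalSeries (l : ℕ) : Type := (Fin l → ℚ) × ℚ → ℂ

/-- The product of a formal series with the monomial `x₁^(s 1) ⋯ x_l^(s l) q^t`. -/
def mulMonomial (s : Fin l → ℚ) (t : ℚ) (f : FormalSeries l) : FormalSeries l :=
  fun e => f (e.1 - s, e.2 - t)

/-- The graded dimension `tr x₁^(λ_1) ⋯ x_l^(λ_l) q^(L(0))` of `U(𝔫 ⊗ ℂ[t, t⁻¹]) · e^μ`; it
is `χ_0` for `μ = 0` and `χ_j` for `μ = λ_j`. -/
def gradedDim (ε : Cocycle l) (μ : Weight l) : FormalSeries l :=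
  fun e => (Module.finrank ℂ (homPart ε μ e.1 e.2) : ℂ)

/-- The normalized graded dimension
`χ'_j = x₁^(-⟨λ_1, λ_j⟩) ⋯ x_l^(-⟨λ_l, λ_j⟩) q^(-⟨λ_j, λ_j⟩ / 2) χ_j`. -/
def normGradedDim (ε : Cocycle l) (j : Fin l) : FormalSeries l :=
  mulMonomial (fun i => -form (fundWeight i) (fundWeight j))
    (-(form (fundWeight j) (fundWeight j) / 2)) (gradedDim ε (fundWeight j))

/-- The ring `ℂ[[x₁, …, x_l, q]]`: the variable `some i` is `x_i` and `none` is `q`. -/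
abbrev CharRing (l : ℕ) : Type := MvPowerSeries (Option (Fin l)) ℂ

/-- The exponents of a monomial of `ℂ[[x₁, …, x_l, q]]`. -/
def exponents (n : Option (Fin l) →₀ ℕ) : (Fin l → ℚ) × ℚ :=
  (fun i => (n (some i) : ℚ), (n none : ℚ))

theorem exponents_injective : Function.Injective (exponents (l := l)) := by
  intro m n h
  ext v
  rcases v with _ | i
  · simpa [exponents] using congrArg Prod.snd h
  · simpa [exponents] using congrFun (congrArg Prod.fst h) i

/-- A power series in `x₁, …, x_l, q` as a formal series: the coefficient is `0` at the exponents
that are not all nonnegative integers. -/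
def toFormal (F : CharRing l) : FormalSeries l :=
  Function.extend exponents (fun n => MvPowerSeries.coeff n F) 0

/-- The family to substitute for `x₁, …, x_l, q`: `x_j` becomes `x_j q`, every other variable is
kept. -/
def shiftVar (j : Fin l) : Option (Fin l) → CharRing l
  | none => MvPowerSeries.X none
  | some i => if i = j then MvPowerSeries.X (some i) * MvPowerSeries.X none
      else MvPowerSeries.X (some i)

theorem shiftVar_hasSubst (j : Fin l) : MvPowerSeries.HasSubst (shiftVar j) := by
  refine MvPowerSeries.hasSubst_of_constantCoeff_zero fun v => ?_
  rcases v with _ | i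
  · simp [shiftVar]
  · by_cases h : i = j <;> simp [shiftVar, h]

/-- `F(x₁, …, x_j q, …, x_l; q)`. -/
def substShift (j : Fin l) (F : CharRing l) : CharRing l := F.subst (shiftVar j)

end PrincipalSubspace

end

/-!
Right multiplication by `e^μ` in the twisted group algebra of `P` is the operator
`T : v ⊗ e^β ↦ ε(β, μ) v ⊗ e^(μ+β)` (`twistedOp`). By the cocycle identity, which is the
associativity of that algebra, the factor `x^α` is all that keeps `T` from commuting with
`Y(e^α, x)`, so that `x_α(m) T = T x_α(m + ⟨α, μ⟩)` (`rootMode_mul_twistedOp`). As `m` runs through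
all integers and `⟨α, μ⟩` is an integer, `T` carries products of root operators to products of root
operators, and it sends `1` to a nonzero multiple of `e^μ`. A product of root operators
applied to `1` has the form `p ⊗ e^β`, on which `T` and the translation `e^μ` agree up to a nonzero
scalar. Hence `e^μ` maps `W(Λ_0)` onto `U(𝔫 ⊗ ℂ[t, t⁻¹]) · e^μ`
(`map_latticeOp_principalSubspace`).

The same products show that each principal subspace is spanned by homogeneous vectors
(`iSup_homPart`). The homogeneous subspaces of `V_P` are finite dimensional because the charges
determine `β` and the weight then bounds the monomials of `M(1)`. On the homogeneous
subspace of charges `r` translation by `μ = ∑ i, m_i λ_i` raises the weight by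
`⟨μ, β⟩ + ⟨μ, μ⟩ / 2 = ∑ i, m_i r_i + ⟨μ, μ⟩ / 2`. For `μ = λ_j` the new part is `r_j`, which is
the effect of replacing `x_j` by `x_j q` (`toFormal_substShift`).

Finally, the exponents that occur in the graded dimension of `W(Λ_0)` are natural numbers: its
vectors lie over sums `β` of positive roots, and the root lattice is even
(`mem_range_exponents_of_gradedDim_ne_zero`).
-/

namespace PrincipalSubspace

variable {l : ℕ}

/-! ### The form on the weight lattice -/

theorem toDiag_add (a b : Weight l) (k : Fin (l + 1)) :
    toDiag (a + b) k = toDiag a k + toDiag b k := by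
  simp [toDiag, add_mul, Finset.sum_add_distrib]

theorem form_add_left (a b c : Weight l) : form (a + b) c = form a c + form b c := by
  simp [form, toDiag_add, add_mul, Finset.sum_add_distrib]

theorem form_comm (a b : Weight l) : form a b = form b a := by
  simp [form, mul_comm]

theorem form_add_right (a b c : Weight l) : form a (b + c) = form a b + form a c := by
  rw [form_comm, form_add_left, form_comm b, form_comm c]

theorem form_zero_left (a : Weight l) : form 0 a = 0 := by
  simp [form, toDiag]

theorem form_zero_right (a : Weight l) : form a 0 = 0 := by
  rw [form_comm, form_zero_left]

theorem form_neg_left (a b : Weight l) : form (-a) b = -form a b := by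
  have := form_add_left (-a) a b
  rw [neg_add_cancel, form_zero_left] at this
  linarith

theorem form_self_nonneg (a : Weight l) : 0 ≤ form a a :=
  Finset.sum_nonneg fun _ _ => mul_self_nonneg _

/-- Pairing with row `i` of the Cartan matrix is a second difference; the missing neighbours of the
two end nodes are accounted for by the boundary values `g 0 = 0` and `g (l + 1) = 0`. -/
theorem sum_simpleRoot_mul (i : Fin l) (g : ℕ → ℚ) (h0 : g 0 = 0) (hl : g (l + 1) = 0) :
    ∑ j : Fin l, (simpleRoot i j : ℚ) * g (j + 1) = 2 * g (i + 1) - g i - g (i + 2) := by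
  have key : ∀ j : ℕ, ((if (i : ℕ) = j then 2 else if (i : ℕ) + 1 = j ∨ j + 1 = i then -1 else 0 :
      ℤ) : ℚ) * g (j + 1) = (if (i : ℕ) = j then 2 * g (i + 1) else 0) -
        (if (i : ℕ) + 1 = j then g (i + 2) else 0) - (if j + 1 = (i : ℕ) then g i else 0) := by
    intro j
    by_cases h1 : (i : ℕ) = j
    · subst h1; simp
    · by_cases h2 : (i : ℕ) + 1 = j
      · subst h2
        have : ¬ ((i : ℕ) + 1 + 1 = i) := by omega
        simp [this]
      · by_cases h3 : j + 1 = (i : ℕ)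
        · rw [if_neg h1, if_pos (Or.inr h3), if_neg h1, if_neg h2, if_pos h3, h3]; simp
        · simp [h1, h2, h3]
  have h1 : ∑ j : Fin l, (simpleRoot i j : ℚ) * g (j + 1) =
      ∑ j ∈ Finset.range l, ((if (i : ℕ) = j then 2 else
        if (i : ℕ) + 1 = j ∨ j + 1 = i then -1 else 0 : ℤ) : ℚ) * g (j + 1) := by
    rw [Finset.sum_range]
    simp only [simpleRoot, Fin.ext_iff]
  rw [h1, Finset.sum_congr rfl fun j _ => key j, Finset.sum_sub_distrib, Finset.sum_sub_distrib,
    Finset.sum_ite_eq, Finset.sum_ite_eq, if_pos (Finset.mem_range.2 i.2)]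
  have h2 : (if (i : ℕ) + 1 ∈ Finset.range l then g (i + 2) else 0) = g (i + 2) := by
    split_ifs with h
    · rfl
    · have : (i : ℕ) + 2 = l + 1 := by
        have := i.2
        rw [Finset.mem_range] at h
        omega
      rw [this, hl]
  have h3 : ∑ j ∈ Finset.range l, (if j + 1 = (i : ℕ) then g i else 0) = g i := by
    rcases hi : (i : ℕ) with _ | m
    · simp [h0]
    · have := i.2
      simp only [Nat.add_right_cancel_iff, Finset.sum_ite_eq', Finset.mem_range]
      rw [if_pos (by omega)]
  rw [h2, h3]
  ring

/-- The simple root `α_i` is the diagonal matrix `E_ii - E_(i+1)(i+1)`. -/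
theorem toDiag_simpleRoot (i : Fin l) (k : Fin (l + 1)) :
    toDiag (simpleRoot i) k = (if k = i.castSucc then 1 else 0) - if k = i.succ then 1 else 0 := by
  have h := sum_simpleRoot_mul i
    (fun m => (if (k : ℕ) < m then 1 else 0) - (m : ℚ) / ((l : ℚ) + 1)) (by simp) (by
      have : (l : ℚ) + 1 ≠ 0 := by positivity
      simp [this, Nat.lt_succ_iff.1 k.2])
  have h2 : toDiag (simpleRoot i) k = ∑ j : Fin l, (simpleRoot i j : ℚ) *
      ((if (k : ℕ) < (j : ℕ) + 1 then 1 else 0) - (((j : ℕ) + 1 : ℕ) : ℚ) / ((l : ℚ) + 1)) := by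
    simp [toDiag, fundDiag]
  rw [h2, h]
  simp only [Fin.ext_iff, Fin.val_castSucc, Fin.val_succ]
  push_cast
  split_ifs <;> first | omega | ring

/-- The simple roots are dual to the fundamental weights. -/
theorem form_simpleRoot (i : Fin l) (b : Weight l) : form (simpleRoot i) b = b i := by
  have h : form (simpleRoot i) b = toDiag b i.castSucc - toDiag b i.succ := by
    simp [form, toDiag_simpleRoot, sub_mul, Finset.sum_sub_distrib]
  rw [h, toDiag, toDiag, ← Finset.sum_sub_distrib, Finset.sum_eq_single i]
  · simp only [fundDiag, Fin.val_castSucc, Fin.val_succ, le_refl, if_true, Nat.not_succ_le_self,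
      if_false]
    ring
  · intro m _ hm
    have : ((i : ℕ) ≤ m) ↔ ((i : ℕ) + 1 ≤ m) := by
      have : (i : ℕ) ≠ m := fun h => hm (Fin.ext h.symm)
      omega
    simp [fundDiag, this]
  · simp

theorem form_simpleRoot_fundWeight (i k : Fin l) :
    form (fundWeight k) (simpleRoot i) = if i = k then 1 else 0 := by
  rw [form_comm, form_simpleRoot, fundWeight, Pi.single_apply]
  split_ifs <;> simp

theorem form_eq_sum_fundWeight (a b : Weight l) :
    form a b = ∑ i, (a i : ℚ) * form (fundWeight i) b := by
  have h : ∀ (i : Fin l) (k : Fin (l + 1)), toDiag (fundWeight i) k = fundDiag i k := by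
    intro i k
    rw [toDiag, Finset.sum_eq_single i] <;> simp +contextual [fundWeight]
  simp only [form, h, Finset.mul_sum]
  rw [Finset.sum_comm]
  refine Finset.sum_congr rfl fun k _ => ?_
  rw [toDiag, Finset.sum_mul]
  exact Finset.sum_congr rfl fun i _ => by ring

/-- The charges determine a weight: the form is nondegenerate. -/
theorem eq_of_form_fundWeight {a b : Weight l}
    (h : ∀ i, form (fundWeight i) a = form (fundWeight i) b) : a = b := by
  ext i
  have h1 : form (simpleRoot i) a = form (simpleRoot i) b := by
    rw [form_eq_sum_fundWeight, form_eq_sum_fundWeight _ b]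
    exact Finset.sum_congr rfl fun k _ => by rw [h]
  rw [form_simpleRoot, form_simpleRoot] at h1
  exact_mod_cast h1

theorem exists_int_form {a : Weight l} (ha : a ∈ rootLattice l) (b : Weight l) :
    ∃ n : ℤ, form a b = n := by
  induction ha using AddSubgroup.closure_induction with
  | mem x hx =>
    obtain ⟨i, rfl⟩ := hx
    exact ⟨b i, form_simpleRoot i b⟩
  | zero => exact ⟨0, by simp [form_zero_left]⟩
  | add x y _ _ hx hy =>
    obtain ⟨m, hm⟩ := hx
    obtain ⟨n, hn⟩ := hy
    exact ⟨m + n, by rw [form_add_left, hm, hn]; push_cast; ring⟩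
  | neg x _ hx =>
    obtain ⟨m, hm⟩ := hx
    exact ⟨-m, by rw [form_neg_left, hm]; push_cast; ring⟩

/-- The cone `Q₊` of the sums of simple roots. -/
def rootCone (l : ℕ) : AddSubmonoid (Weight l) := AddSubmonoid.closure (Set.range simpleRoot)

theorem mem_rootLattice_of_mem_rootCone {a : Weight l} (ha : a ∈ rootCone l) :
    a ∈ rootLattice l :=
  AddSubgroup.le_closure_toAddSubmonoid _ ha

theorem mem_rootCone_of_mem_positiveRoots {a : Weight l} (ha : a ∈ positiveRoots l) :
    a ∈ rootCone l := by
  obtain ⟨i, j, -, rfl⟩ := ha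
  exact AddSubmonoid.sum_mem _ fun k _ => AddSubmonoid.subset_closure ⟨k, rfl⟩

/-- The root lattice is even and positive. -/
theorem exists_nat_half_form_self {a : Weight l} (ha : a ∈ rootCone l) :
    ∃ n : ℕ, form a a / 2 = n := by
  suffices h : ∃ n : ℤ, form a a / 2 = n by
    obtain ⟨n, hn⟩ := h
    have h0 : 0 ≤ n := by
      have : (0 : ℚ) ≤ n := by rw [← hn]; exact div_nonneg (form_self_nonneg a) (by norm_num)
      exact_mod_cast this
    lift n to ℕ using h0
    exact ⟨n, by simpa using hn⟩
  induction ha using AddSubmonoid.closure_induction with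
  | mem x hx =>
    obtain ⟨i, rfl⟩ := hx
    exact ⟨1, by rw [form_simpleRoot]; simp [simpleRoot]⟩
  | zero => exact ⟨0, by simp [form_zero_left]⟩
  | add x y hx _ hm hn =>
    obtain ⟨m, hm⟩ := hm
    obtain ⟨n, hn⟩ := hn
    obtain ⟨c, hc⟩ := exists_int_form (mem_rootLattice_of_mem_rootCone hx) y
    refine ⟨m + n + c, ?_⟩
    rw [form_add_left, form_add_right, form_add_right, form_comm y x, hc]
    push_cast
    linarith

theorem exists_nat_form_fundWeight {a : Weight l} (ha : a ∈ rootCone l) (k : Fin l) :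
    ∃ n : ℕ, form (fundWeight k) a = n := by
  induction ha using AddSubmonoid.closure_induction with
  | mem x hx =>
    obtain ⟨i, rfl⟩ := hx
    exact ⟨if i = k then 1 else 0, by rw [form_simpleRoot_fundWeight]; split_ifs <;> simp⟩
  | zero => exact ⟨0, by simp [form_zero_right]⟩
  | add x y _ _ hm hn =>
    obtain ⟨m, hm⟩ := hm
    obtain ⟨n, hn⟩ := hn
    exact ⟨m + n, by rw [form_add_right, hm, hn]; push_cast; ring⟩

/-! ### Weights in the Fock space -/

/-- The subspace of `M(1)` of weight `d`. -/
noncomputable def fockWeight (l : ℕ) (d : ℂ) : Submodule ℂ (FockSpace l) :=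
  Module.End.eigenspace (degreeDer l).toLinearMap d

theorem mem_fockWeight {d : ℂ} {p : FockSpace l} :
    p ∈ fockWeight l d ↔ degreeDer l p = d • p :=
  Module.End.mem_eigenspace_iff

theorem degreeDer_monomial (s : Fin l × ℕ →₀ ℕ) (c : ℂ) :
    degreeDer l (MvPolynomial.monomial s c) =
      (monWeight s : ℂ) • MvPolynomial.monomial s c := by
  rw [degreeDer, MvPolynomial.mkDerivation_monomial, monWeight, Finsupp.sum, Finsupp.sum,
    Int.cast_sum, Finset.sum_smul, Finset.smul_sum]
  refine Finset.sum_congr rfl fun v hv => ?_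
  have hle : Finsupp.single v 1 ≤ s := by
    rw [Finsupp.single_le_iff]
    exact Nat.one_le_iff_ne_zero.2 (Finsupp.mem_support_iff.1 hv)
  rw [smul_eq_mul, mul_smul_comm, MvPolynomial.X, MvPolynomial.monomial_mul,
    tsub_add_cancel_of_le hle, MvPolynomial.smul_monomial, MvPolynomial.smul_monomial,
    MvPolynomial.smul_monomial]
  congr 1
  simp only [smul_eq_mul]
  push_cast
  ring

theorem coeff_degreeDer (s : Fin l × ℕ →₀ ℕ) (p : FockSpace l) :
    MvPolynomial.coeff s (degreeDer l p) = (monWeight s : ℂ) * MvPolynomial.coeff s p := by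
  classical
  induction p using MvPolynomial.induction_on' with
  | monomial t c =>
    rw [degreeDer_monomial, MvPolynomial.coeff_smul, MvPolynomial.coeff_monomial, smul_eq_mul]
    split_ifs with h
    · rw [h]
    · simp
  | add p q hp hq => rw [map_add, MvPolynomial.coeff_add, MvPolynomial.coeff_add, hp, hq]; ring

theorem mem_fockWeight_iff_coeff {d : ℂ} {p : FockSpace l} :
    p ∈ fockWeight l d ↔ ∀ s, MvPolynomial.coeff s p ≠ 0 → (monWeight s : ℂ) = d := by
  rw [mem_fockWeight, MvPolynomial.ext_iff]
  refine forall_congr' fun s => ?_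
  rw [coeff_degreeDer, MvPolynomial.coeff_smul, smul_eq_mul, mul_eq_mul_right_iff, or_comm,
    or_iff_not_imp_left]

theorem finite_monWeight_eq (d : ℂ) : {s : Fin l × ℕ →₀ ℕ | (monWeight s : ℂ) = d}.Finite := by
  by_cases h : ∃ s₀ : Fin l × ℕ →₀ ℕ, (monWeight s₀ : ℂ) = d
  swap
  · refine Set.Finite.subset Set.finite_empty fun s hs => h ⟨s, hs⟩
  obtain ⟨s₀, rfl⟩ := h
  -- Only the variables of weight at most `N` occur, each with exponent at most `N`.
  set N := (monWeight s₀).toNat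
  have hN : (N : ℤ) = monWeight s₀ := Int.toNat_of_nonneg (monWeight_nonneg _)
  have key : ∀ s : Fin l × ℕ →₀ ℕ, monWeight s = monWeight s₀ → ∀ v,
      (s v : ℤ) * ((v.2 : ℤ) + 1) ≤ N := by
    intro s hs v
    rw [hN, ← hs, monWeight, Finsupp.sum]
    by_cases hv : v ∈ s.support
    · exact Finset.single_le_sum (f := fun v => (s v : ℤ) * ((v.2 : ℤ) + 1))
        (fun _ _ => by positivity) hv
    · rw [Finsupp.notMem_support_iff.1 hv]
      simpa using Finset.sum_nonneg fun v _ => (by positivity : 0 ≤ (s v : ℤ) * ((v.2 : ℤ) + 1))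
  refine (Set.finite_Iic (Finsupp.onFinset (Finset.univ ×ˢ Finset.range N)
    (fun v => if v.2 < N then N else 0) fun v hv => ?_)).subset fun s hs => ?_
  · simp only [ne_eq, ite_eq_right_iff, Classical.not_imp] at hv
    simpa using hv.1
  · intro v
    have h1 := key s (by exact_mod_cast hs) v
    simp only [Finsupp.onFinset_apply]
    split_ifs with hv
    · have : (s v : ℤ) ≤ N := by nlinarith
      exact_mod_cast this
    · by_contra h2
      have h3 : (1 : ℤ) ≤ s v := by omega
      have h4 : (N : ℤ) ≤ v.2 := by omega
      nlinarith

instance finiteDimensional_fockWeight (d : ℂ) : FiniteDimensional ℂ (fockWeight l d) := by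
  have hf := finite_monWeight_eq (l := l) d
  have hle : fockWeight l d ≤ Submodule.span ℂ
      ((fun s => (MvPolynomial.monomial s 1 : FockSpace l)) '' {s | (monWeight s : ℂ) = d}) := by
    intro p hp
    rw [mem_fockWeight_iff_coeff] at hp
    rw [p.as_sum]
    refine Submodule.sum_mem _ fun s hs => ?_
    rw [← mul_one (MvPolynomial.coeff s p), ← smul_eq_mul, ← MvPolynomial.smul_monomial]
    exact Submodule.smul_mem _ _
      (Submodule.subset_span ⟨s, hp s (MvPolynomial.mem_support_iff.1 hs), rfl⟩)
  have := FiniteDimensional.span_of_finite ℂ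
    (hf.image fun s => (MvPolynomial.monomial s 1 : FockSpace l))
  exact Submodule.finiteDimensional_of_le hle

/-- Differentiating by `α_i(-n-1)` lowers the weight by `n + 1`. -/
theorem degreeDer_pderiv (v : Fin l × ℕ) (p : FockSpace l) :
    degreeDer l (MvPolynomial.pderiv v p) =
      MvPolynomial.pderiv v (degreeDer l p) - ((v.2 : ℂ) + 1) • MvPolynomial.pderiv v p := by
  have h : ⁅degreeDer l, MvPolynomial.pderiv (R := ℂ) v⁆ =
      -(((v.2 : ℂ) + 1) • MvPolynomial.pderiv (R := ℂ) v) := by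
    refine MvPolynomial.derivation_ext fun w => ?_
    rw [Derivation.commutator_apply, degreeDer, MvPolynomial.mkDerivation_X]
    by_cases hw : v = w
    · subst hw; simp
    · simp [MvPolynomial.pderiv_X_of_ne (Ne.symm hw)]
  have h2 := DFunLike.congr_fun h p
  rw [Derivation.commutator_apply, Derivation.neg_apply, Derivation.smul_apply] at h2
  linear_combination (exp := 1) h2

theorem heis_mem_fockWeight (μ : Weight l) (n : ℤ) {d : ℂ} {p : FockSpace l}
    (hp : p ∈ fockWeight l d) : heis μ n p ∈ fockWeight l (d - n) := by
  rw [mem_fockWeight] at hp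
  rcases n with (_ | n) | n
  · exact Submodule.zero_mem _
  · have : heis μ (Int.ofNat (n + 1)) =
        ∑ i, (((n : ℂ) + 1) * ((form μ (simpleRoot i) : ℚ) : ℂ)) •
          (MvPolynomial.pderiv (R := ℂ) (i, n)).toLinearMap := rfl
    rw [this, LinearMap.sum_apply]
    refine Submodule.sum_mem _ fun i _ => Submodule.smul_mem _ _ ?_
    rw [mem_fockWeight]
    change degreeDer l (MvPolynomial.pderiv (i, n) p) = _ • MvPolynomial.pderiv (i, n) p
    rw [degreeDer_pderiv, hp, Derivation.map_smul, ← sub_smul]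
    simp
  · have : heis μ (Int.negSucc n) p =
        (∑ i, ((form μ (fundWeight i) : ℚ) : ℂ) • MvPolynomial.X (i, n)) * p := rfl
    rw [this, Finset.sum_mul]
    refine Submodule.sum_mem _ fun i _ => ?_
    rw [smul_mul_assoc]
    refine Submodule.smul_mem _ _ ?_
    rw [mem_fockWeight, Derivation.leibniz, hp, degreeDer, MvPolynomial.mkDerivation_X]
    simp only [smul_eq_mul, Int.cast_negSucc, MvPolynomial.smul_eq_C_mul, map_sub, map_neg,
      map_add, map_natCast, map_one, Nat.cast_add, Nat.cast_one]
    ring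

/-- The exponential of a power series whose coefficient at `x ^ n` shifts the weight by `σ n`
has the same property. -/
theorem expCoeff_mem_fockWeight (σ : ℂ) {f : PowerSeries (Module.End ℂ (FockSpace l))}
    (hf : ∀ (n : ℕ) {d : ℂ} {p : FockSpace l}, p ∈ fockWeight l d →
      PowerSeries.coeff n f p ∈ fockWeight l (d + σ * n))
    (n : ℕ) {d : ℂ} {p : FockSpace l} (hp : p ∈ fockWeight l d) :
    expCoeff f n p ∈ fockWeight l (d + σ * n) := by
  have hpow : ∀ (k n : ℕ) {d : ℂ} {p : FockSpace l}, p ∈ fockWeight l d →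
      PowerSeries.coeff n (f ^ k) p ∈ fockWeight l (d + σ * n) := by
    intro k
    induction k with
    | zero =>
      intro n d p hp
      rw [pow_zero, PowerSeries.coeff_one]
      split_ifs with h
      · subst h; simpa using hp
      · exact Submodule.zero_mem _
    | succ k ih =>
      intro n d p hp
      rw [pow_succ, PowerSeries.coeff_mul, LinearMap.sum_apply]
      refine Submodule.sum_mem _ fun c hc => ?_
      have h := ih c.1 (hf c.2 hp)
      rw [Finset.HasAntidiagonal.mem_antidiagonal] at hc
      rw [Module.End.mul_apply, ← hc]
      convert h using 2
      push_cast
      ring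
  rw [expCoeff, LinearMap.sum_apply]
  exact Submodule.sum_mem _ fun k _ => Submodule.smul_mem _ _ (hpow k n hp)

theorem Eplus_mem_fockWeight (μ : Weight l) (b : ℕ) {d : ℂ} {p : FockSpace l}
    (hp : p ∈ fockWeight l d) : Eplus μ b p ∈ fockWeight l (d - b) := by
  have h := expCoeff_mem_fockWeight (f := plusExponent μ) (-1) (fun n {d p} hp => by
    rw [plusExponent, PowerSeries.coeff_mk]
    refine Submodule.smul_mem _ _ ?_
    convert heis_mem_fockWeight μ n hp using 2
    push_cast
    ring) b hp
  rwa [neg_one_mul, ← sub_eq_add_neg] at h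

theorem Eminus_mem_fockWeight (μ : Weight l) (a : ℕ) {d : ℂ} {p : FockSpace l}
    (hp : p ∈ fockWeight l d) : Eminus μ a p ∈ fockWeight l (d + a) := by
  have h := expCoeff_mem_fockWeight (f := minusExponent μ) 1 (fun n {d p} hp => by
    rw [minusExponent, PowerSeries.coeff_mk]
    refine Submodule.smul_mem _ _ ?_
    convert heis_mem_fockWeight μ (-n) hp using 2
    push_cast
    ring) a hp
  rwa [one_mul] at h

theorem vertexPart_mem_fockWeight (μ : Weight l) (t : ℚ) {d : ℂ} {p : FockSpace l}
    (hp : p ∈ fockWeight l d) : vertexPart μ t p ∈ fockWeight l (d + t) := by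
  refine finsum_induction (· ∈ fockWeight l (d + t)) (Submodule.zero_mem _)
    (fun _ _ => Submodule.add_mem _) fun c => ?_
  have h := Eminus_mem_fockWeight μ c.1.1 (Eplus_mem_fockWeight μ c.1.2 hp)
  have hc : ((c.1.1 : ℂ)) - c.1.2 = t := by exact_mod_cast congrArg (Rat.cast (K := ℂ)) c.2
  convert h using 2
  rw [← hc]
  ring

/-! ### Homogeneous subspaces of the lattice space -/

@[simp]
theorem latticeOp_single (μ β : Weight l) (p : FockSpace l) :
    latticeOp μ (Finsupp.single β p) = Finsupp.single (μ + β) p := by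
  simp [latticeOp]

theorem latticeOp_apply_add (μ β : Weight l) (w : LatticeSpace l) :
    latticeOp μ w (μ + β) = w β := by
  classical
  induction w using Finsupp.induction_linear with
  | zero => simp
  | add f g hf hg => rw [map_add (latticeOp μ), Finsupp.add_apply, hf, hg, Finsupp.add_apply]
  | single γ p =>
    rw [latticeOp_single, Finsupp.single_apply, Finsupp.single_apply]
    simp

theorem latticeOp_comp_neg (μ : Weight l) (w : LatticeSpace l) :
    latticeOp μ (latticeOp (-μ) w) = w := by
  induction w using Finsupp.induction_linear with
  | zero => simp
  | add f g hf hg => rw [map_add, map_add, hf, hg]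
  | single γ p => simp

theorem latticeOp_injective (μ : Weight l) : Function.Injective (latticeOp μ) := by
  intro v w h
  ext β : 1
  rw [← latticeOp_apply_add μ, h, latticeOp_apply_add]

theorem zeroMode_apply (μ β : Weight l) (w : LatticeSpace l) :
    zeroMode μ w β = ((form μ β : ℚ) : ℂ) • w β := by
  classical
  induction w using Finsupp.induction_linear with
  | zero => simp
  | add f g hf hg => rw [map_add, Finsupp.add_apply, hf, hg, Finsupp.add_apply, smul_add]
  | single γ p =>
    have : zeroMode μ (Finsupp.single γ p) =
        ((form μ γ : ℚ) : ℂ) • (Finsupp.single γ p : LatticeSpace l) := by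
      simp [zeroMode]
    rw [this, Finsupp.smul_apply, Finsupp.single_apply]
    split_ifs with h
    · rw [h]
    · simp

theorem virasoroZero_apply (β : Weight l) (w : LatticeSpace l) :
    virasoroZero l w β = degreeDer l (w β) + ((form β β / 2 : ℚ) : ℂ) • w β := by
  classical
  induction w using Finsupp.induction_linear with
  | zero => simp
  | add f g hf hg =>
    rw [map_add, Finsupp.add_apply, hf, hg, Finsupp.add_apply, smul_add, map_add]
    abel
  | single γ p =>
    have : virasoroZero l (Finsupp.single γ p) = (Finsupp.single γ
        (degreeDer l p + ((form γ γ / 2 : ℚ) : ℂ) • p) : LatticeSpace l) := by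
      rw [virasoroZero, Finsupp.lsum_single]
      rfl
    rw [this, Finsupp.single_apply, Finsupp.single_apply]
    split_ifs with h
    · rw [h]
    · simp

/-- A vector is homogeneous when each of its nonzero components `w β ⊗ e^β` is: the charges
are those of `β`, and the weight is that of `w β` plus `⟨β, β⟩ / 2`. -/
theorem mem_homogeneous {r : Fin l → ℚ} {k : ℚ} {w : LatticeSpace l} :
    w ∈ homogeneous r k ↔ ∀ β, w β ≠ 0 → (∀ i, form (fundWeight i) β = r i) ∧
      w β ∈ fockWeight l ((k - form β β / 2 : ℚ) : ℂ) := by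
  simp only [homogeneous, Submodule.mem_inf, Submodule.mem_iInf, Module.End.mem_eigenspace_iff,
    Finsupp.ext_iff, zeroMode_apply, virasoroZero_apply, Finsupp.smul_apply, mem_fockWeight]
  constructor
  · rintro ⟨h1, h2⟩ β hβ
    refine ⟨fun i => ?_, ?_⟩
    · exact_mod_cast smul_left_injective ℂ hβ (h1 i β)
    · rw [Rat.cast_sub, sub_smul, ← h2 β, add_sub_cancel_right]
  · intro h
    refine ⟨fun i β => ?_, fun β => ?_⟩
    · by_cases hβ : w β = 0
      · simp [hβ]
      · rw [(h β hβ).1 i]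
    · by_cases hβ : w β = 0
      · simp [hβ]
      · rw [(h β hβ).2, ← add_smul, ← Rat.cast_add, sub_add_cancel]

theorem single_mem_homogeneous (β : Weight l) {d : ℚ} {p : FockSpace l}
    (hp : p ∈ fockWeight l (d : ℂ)) :
    (Finsupp.single β p : LatticeSpace l) ∈
      homogeneous (fun i => form (fundWeight i) β) (d + form β β / 2) := by
  classical
  rw [mem_homogeneous]
  intro γ hγ
  have h : β = γ := by
    by_contra h
    exact hγ (Finsupp.single_eq_of_ne' h)
  subst h
  simpa using hp

/-- Translation by `μ` moves the charges by `⟨λ_i, μ⟩`, and the weight by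
`⟨μ, μ⟩ / 2` plus the pairing of `μ` with the charges. -/
theorem latticeOp_mem_homogeneous_iff (μ : Weight l) {r : Fin l → ℚ} {k : ℚ}
    {w : LatticeSpace l} :
    latticeOp μ w ∈ homogeneous (fun i => r i + form (fundWeight i) μ)
      (k + ∑ i, (μ i : ℚ) * r i + form μ μ / 2) ↔ w ∈ homogeneous r k := by
  rw [mem_homogeneous, mem_homogeneous, ← (Equiv.addLeft μ).forall_congr_right]
  refine forall_congr' fun β => ?_
  simp only [Equiv.coe_addLeft, latticeOp_apply_add]
  refine imp_congr_right fun _ => ?_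
  have h1 : (∀ i, form (fundWeight i) (μ + β) = r i + form (fundWeight i) μ) ↔
      ∀ i, form (fundWeight i) β = r i :=
    forall_congr' fun i => by
      rw [form_add_right]
      constructor <;> intro h <;> linarith
  rw [h1]
  refine and_congr_right fun h => ?_
  have h2 : form μ β = ∑ i, (μ i : ℚ) * r i := by
    rw [form_eq_sum_fundWeight]
    exact Finset.sum_congr rfl fun i _ => by rw [h]
  have h3 : k + ∑ i, (μ i : ℚ) * r i + form μ μ / 2 - form (μ + β) (μ + β) / 2 =
      k - form β β / 2 := by
    rw [form_add_left, form_add_right, form_add_right, form_comm β μ, h2]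
    ring
  rw [h3]

theorem map_latticeOp_homogeneous (μ : Weight l) (r : Fin l → ℚ) (k : ℚ) :
    (homogeneous r k).map (latticeOp μ) = homogeneous (fun i => r i + form (fundWeight i) μ)
      (k + ∑ i, (μ i : ℚ) * r i + form μ μ / 2) := by
  ext w
  constructor
  · rintro ⟨v, hv, rfl⟩
    exact (latticeOp_mem_homogeneous_iff μ).2 hv
  · intro hw
    rw [← latticeOp_comp_neg μ w] at hw ⊢
    exact ⟨_, (latticeOp_mem_homogeneous_iff μ).1 hw, rfl⟩

/-- The charges leave room for a single `e^β`, and the weight spaces of `M(1)` are finite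
dimensional. -/
instance finiteDimensional_homogeneous (r : Fin l → ℚ) (k : ℚ) :
    FiniteDimensional ℂ (homogeneous (l := l) r k) := by
  by_cases h : ∃ β : Weight l, ∀ i, form (fundWeight i) β = r i
  · obtain ⟨β, hβ⟩ := h
    have hle : homogeneous r k ≤ (fockWeight l ((k - form β β / 2 : ℚ) : ℂ)).map
        (Finsupp.lsingle β : FockSpace l →ₗ[ℂ] LatticeSpace l) := by
      intro w hw
      rw [mem_homogeneous] at hw
      have hs : w = Finsupp.single β (w β) := by
        ext γ : 1
        by_cases hγ : γ = β
        · rw [hγ, Finsupp.single_eq_same]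
        · rw [Finsupp.single_eq_of_ne hγ]
          by_contra h0
          exact hγ (eq_of_form_fundWeight fun i => ((hw γ h0).1 i).trans (hβ i).symm)
      refine ⟨w β, ?_, hs.symm⟩
      by_cases h0 : w β = 0
      · rw [h0]; exact Submodule.zero_mem _
      · exact (hw β h0).2
    exact Submodule.finiteDimensional_of_le hle
  · have hbot : homogeneous (l := l) r k = ⊥ := by
      rw [eq_bot_iff]
      intro w hw
      rw [mem_homogeneous] at hw
      rw [Submodule.mem_bot]
      ext β : 1
      by_contra h0
      exact h ⟨β, (hw β h0).1⟩
    rw [hbot]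
    infer_instance

/-! ### Translation of the principal subspaces -/

theorem rootMode_single (ε : Cocycle l) (α β : Weight l) (m : ℤ) (p : FockSpace l) :
    rootMode ε α m (Finsupp.single β p) = Finsupp.single (α + β)
      ((ε.toFun α β : ℂ) • vertexPart α (-m - 1 - form α β) p) := by
  simp [rootMode, vertexCoeff]

/-- The operators `x_α(m)`, which generate the action of `U(𝔫 ⊗ ℂ[t, t⁻¹])`. -/
def rootModes (ε : Cocycle l) : Set (Module.End ℂ (LatticeSpace l)) :=
  {T | ∃ α ∈ positiveRoots l, ∃ m : ℤ, T = rootMode ε α m}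

theorem principalSubspace_eq_span (ε : Cocycle l) (μ : Weight l) :
    principalSubspace ε μ = Submodule.span ℂ
      ((fun x : Module.End ℂ (LatticeSpace l) => x (latticeVec μ)) ''
        (Submonoid.closure (rootModes ε) : Set (Module.End ℂ (LatticeSpace l)))) := by
  rw [principalSubspace, nilpotentAlgebra, Algebra.adjoin_eq_span, Submodule.map_span]
  rfl

/-- A product of operators `x_α(m)` sends `e^μ` to a single homogeneous vector `p ⊗ e^(β + μ)`
with `β ∈ Q₊`. -/
theorem exists_apply_latticeVec_eq_single {ε : Cocycle l}
    {x : Module.End ℂ (LatticeSpace l)} (hx : x ∈ Submonoid.closure (rootModes ε))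
    (μ : Weight l) : ∃ β ∈ rootCone l, ∃ (d : ℚ) (p : FockSpace l),
      p ∈ fockWeight l (d : ℂ) ∧ x (latticeVec μ) = Finsupp.single (β + μ) p := by
  induction hx using Submonoid.closure_induction_left with
  | one =>
    refine ⟨0, zero_mem _, 0, 1, ?_, by simp [latticeVec]⟩
    rw [mem_fockWeight]
    simp
  | mul_left x hx y _ ih =>
    obtain ⟨α, hα, m, rfl⟩ := hx
    obtain ⟨β, hβ, d, p, hp, hy⟩ := ih
    refine ⟨α + β, add_mem (mem_rootCone_of_mem_positiveRoots hα) hβ,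
      d + (-m - 1 - form α (β + μ)), _, ?_,
      by rw [Module.End.mul_apply, hy, rootMode_single, add_assoc]⟩
    rw [Rat.cast_add]
    exact Submodule.smul_mem _ _ (vertexPart_mem_fockWeight α _ hp)

/-- The operator `v ⊗ e^β ↦ ε(β, μ) v ⊗ e^(μ+β)`, right multiplication by `e^μ` in the
twisted group algebra of `P`. -/
noncomputable def twistedOp (ε : Cocycle l) (μ : Weight l) : Module.End ℂ (LatticeSpace l) :=
  Finsupp.lsum ℂ fun β => (ε.toFun β μ : ℂ) • Finsupp.lsingle (μ + β)

theorem twistedOp_single (ε : Cocycle l) (μ β : Weight l) (p : FockSpace l) :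
    twistedOp ε μ (Finsupp.single β p) =
      (ε.toFun β μ : ℂ) • latticeOp μ (Finsupp.single β p) := by
  simp [twistedOp]

theorem twistedOp_latticeVec_zero (ε : Cocycle l) (μ : Weight l) :
    twistedOp ε μ (latticeVec 0) = (ε.toFun 0 μ : ℂ) • latticeVec μ := by
  rw [latticeVec, twistedOp_single, latticeOp_single, add_zero, latticeVec]

/-- Associativity of the twisted group algebra: right multiplication by `e^μ` commutes with the
root operators up to the shift of the mode caused by `x^α`. -/
theorem rootMode_mul_twistedOp (ε : Cocycle l) (α μ : Weight l) {m n : ℤ}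
    (h : form α μ = n) :
    rootMode ε α m * twistedOp ε μ = twistedOp ε μ * rootMode ε α (m + n) := by
  refine Finsupp.lhom_ext fun β p => ?_
  rw [Module.End.mul_apply, Module.End.mul_apply, twistedOp_single, map_smul, latticeOp_single,
    rootMode_single, rootMode_single, twistedOp_single, latticeOp_single, Finsupp.smul_single,
    Finsupp.smul_single, smul_smul, smul_smul]
  have hc : (ε.toFun α β : ℂ) * ε.toFun (α + β) μ = ε.toFun β μ * ε.toFun α (β + μ) := by
    exact_mod_cast ε.cocycle α β μ
  have hm : (-(m : ℚ) - 1 - form α (μ + β)) = -((m + n : ℤ) : ℚ) - 1 - form α β := by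
    rw [form_add_right, h]
    push_cast
    ring
  rw [hm, mul_comm (ε.toFun (α + β) μ : ℂ), hc, add_comm β μ, add_left_comm]

theorem rootMode_mul_twistedOp_mem {ε : Cocycle l} (μ : Weight l)
    {x : Module.End ℂ (LatticeSpace l)} (hx : x ∈ Submonoid.closure (rootModes ε)) :
    ∃ y ∈ Submonoid.closure (rootModes ε), x * twistedOp ε μ = twistedOp ε μ * y := by
  induction hx using Submonoid.closure_induction with
  | mem x hx =>
    obtain ⟨α, hα, m, rfl⟩ := hx
    obtain ⟨n, hn⟩ :=
      exists_int_form (mem_rootLattice_of_mem_rootCone (mem_rootCone_of_mem_positiveRoots hα)) μ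
    exact ⟨_, Submonoid.subset_closure ⟨α, hα, m + n, rfl⟩, rootMode_mul_twistedOp ε α μ hn⟩
  | one => exact ⟨1, one_mem _, by simp⟩
  | mul x y _ _ hx hy =>
    obtain ⟨x', hx', hx⟩ := hx
    obtain ⟨y', hy', hy⟩ := hy
    exact ⟨x' * y', mul_mem hx' hy', by rw [mul_assoc, hy, ← mul_assoc, hx, mul_assoc]⟩

theorem twistedOp_mul_mem {ε : Cocycle l} (μ : Weight l)
    {x : Module.End ℂ (LatticeSpace l)} (hx : x ∈ Submonoid.closure (rootModes ε)) :
    ∃ y ∈ Submonoid.closure (rootModes ε), y * twistedOp ε μ = twistedOp ε μ * x := by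
  induction hx using Submonoid.closure_induction with
  | mem x hx =>
    obtain ⟨α, hα, m, rfl⟩ := hx
    obtain ⟨n, hn⟩ :=
      exists_int_form (mem_rootLattice_of_mem_rootCone (mem_rootCone_of_mem_positiveRoots hα)) μ
    refine ⟨_, Submonoid.subset_closure ⟨α, hα, m - n, rfl⟩, ?_⟩
    rw [rootMode_mul_twistedOp ε α μ hn, sub_add_cancel]
  | one => exact ⟨1, one_mem _, by simp⟩
  | mul x y _ _ hx hy =>
    obtain ⟨x', hx', hx⟩ := hx
    obtain ⟨y', hy', hy⟩ := hy
    exact ⟨x' * y', mul_mem hx' hy', by rw [mul_assoc, hy, ← mul_assoc, hx, mul_assoc]⟩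

/-- On a product of root operators applied to `1`, translation by `μ` agrees with `twistedOp` up
to a nonzero scalar. -/
theorem exists_unit_smul_latticeOp {ε : Cocycle l} (μ : Weight l)
    {x y : Module.End ℂ (LatticeSpace l)} (hx : x ∈ Submonoid.closure (rootModes ε))
    (h : y * twistedOp ε μ = twistedOp ε μ * x) :
    ∃ c : ℂˣ, y (latticeVec μ) = (c : ℂ) • latticeOp μ (x (latticeVec 0)) := by
  obtain ⟨β, -, d, p, -, hp⟩ := exists_apply_latticeVec_eq_single hx 0
  have h1 := LinearMap.congr_fun h (latticeVec 0)
  rw [Module.End.mul_apply, Module.End.mul_apply, hp, twistedOp_single,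
    twistedOp_latticeVec_zero, map_smul, ← hp] at h1
  refine ⟨(ε.toFun 0 μ)⁻¹ * ε.toFun (β + 0) μ, ?_⟩
  rw [Units.val_mul, ← smul_smul, ← h1, smul_smul, Units.inv_mul, one_smul]

/-- Translation by any `μ ∈ P` takes `W(Λ_0)` onto the space generated by `e^μ`. -/
theorem map_latticeOp_principalSubspace (ε : Cocycle l) (μ : Weight l) :
    (principalSubspace ε 0).map (latticeOp μ) = principalSubspace ε μ := by
  rw [principalSubspace_eq_span, principalSubspace_eq_span, Submodule.map_span]
  refine le_antisymm (Submodule.span_le.2 ?_) (Submodule.span_le.2 ?_)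
  · rintro _ ⟨_, ⟨x, hx, rfl⟩, rfl⟩
    obtain ⟨y, hy, h⟩ := twistedOp_mul_mem μ hx
    obtain ⟨c, hc⟩ := exists_unit_smul_latticeOp μ hx h
    have : latticeOp μ (x (latticeVec 0)) = ((c⁻¹ : ℂˣ) : ℂ) • y (latticeVec μ) := by
      rw [hc, smul_smul, Units.inv_mul, one_smul]
    change latticeOp μ (x (latticeVec 0)) ∈ _
    rw [this]
    exact Submodule.smul_mem _ _ (Submodule.subset_span ⟨y, hy, rfl⟩)
  · rintro _ ⟨y, hy, rfl⟩
    obtain ⟨x, hx, h⟩ := rootMode_mul_twistedOp_mem μ hy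
    obtain ⟨c, hc⟩ := exists_unit_smul_latticeOp μ hx h
    change y (latticeVec μ) ∈ _
    rw [hc]
    exact Submodule.smul_mem _ _ (Submodule.subset_span ⟨_, ⟨x, hx, rfl⟩, rfl⟩)

theorem map_latticeOp_homPart (ε : Cocycle l) (μ : Weight l) (r : Fin l → ℚ) (k : ℚ) :
    (homPart ε 0 r k).map (latticeOp μ) = homPart ε μ (fun i => r i + form (fundWeight i) μ)
      (k + ∑ i, (μ i : ℚ) * r i + form μ μ / 2) := by
  rw [homPart, Submodule.map_inf _ (latticeOp_injective μ), map_latticeOp_principalSubspace,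
    map_latticeOp_homogeneous, homPart]

theorem map_latticeOp_fundWeight_homPart (ε : Cocycle l) (j : Fin l) (r : Fin l → ℚ) (k : ℚ) :
    (homPart ε 0 r k).map (latticeOp (fundWeight j)) =
      homPart ε (fundWeight j) (fun i => r i + form (fundWeight i) (fundWeight j))
        (k + r j + form (fundWeight j) (fundWeight j) / 2) := by
  have h : ∑ i, ((fundWeight j i : ℤ) : ℚ) * r i = r j := by
    rw [Finset.sum_eq_single j] <;> simp +contextual [fundWeight]
  rw [map_latticeOp_homPart, h]

/-! ### Graded dimensions -/

theorem iSup_homPart (ε : Cocycle l) (μ : Weight l) :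
    (⨆ (r : Fin l → ℚ) (k : ℚ), homPart ε μ r k) = principalSubspace ε μ := by
  refine le_antisymm (iSup_le fun r => iSup_le fun k => inf_le_left) ?_
  have hspan := principalSubspace_eq_span ε μ
  conv_lhs => rw [hspan]
  refine Submodule.span_le.2 ?_
  rintro _ ⟨x, hx, rfl⟩
  obtain ⟨β, -, d, p, hp, h⟩ := exists_apply_latticeVec_eq_single hx μ
  refine Submodule.mem_iSup_of_mem (fun i => form (fundWeight i) (β + μ))
    (Submodule.mem_iSup_of_mem (d + form (β + μ) (β + μ) / 2) ⟨?_, ?_⟩)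
  · rw [hspan]
    exact Submodule.subset_span ⟨x, hx, rfl⟩
  · change x (latticeVec μ) ∈ _
    rw [h]
    exact single_mem_homogeneous _ hp

instance finiteDimensional_homPart (ε : Cocycle l) (μ : Weight l) (r : Fin l → ℚ) (k : ℚ) :
    FiniteDimensional ℂ (homPart ε μ r k) :=
  Submodule.finiteDimensional_of_le (inf_le_right : homPart ε μ r k ≤ homogeneous r k)

/-- `W(Λ_0)` lives over the cone `Q₊`. -/
theorem mem_rootCone_of_mem_principalSubspace {ε : Cocycle l} {w : LatticeSpace l}
    (hw : w ∈ principalSubspace ε 0) {β : Weight l} (hβ : w β ≠ 0) : β ∈ rootCone l := by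
  have hle : principalSubspace ε 0 ≤ Finsupp.supported (FockSpace l) ℂ (rootCone l : Set _) := by
    rw [principalSubspace_eq_span, Submodule.span_le]
    rintro _ ⟨x, hx, rfl⟩
    obtain ⟨γ, hγ, d, p, -, h⟩ := exists_apply_latticeVec_eq_single hx 0
    change x (latticeVec 0) ∈ _
    rw [h, add_zero]
    exact Finsupp.single_mem_supported _ _ hγ
  exact (Finsupp.mem_supported _ _).1 (hle hw) (Finsupp.mem_support_iff.2 hβ)

theorem mem_range_exponents_of_gradedDim_ne_zero {ε : Cocycle l} {e : (Fin l → ℚ) × ℚ}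
    (he : gradedDim ε 0 e ≠ 0) : e ∈ Set.range (exponents (l := l)) := by
  have hne : homPart ε 0 e.1 e.2 ≠ ⊥ := by
    intro h
    rw [gradedDim, h, finrank_bot] at he
    exact he Nat.cast_zero
  obtain ⟨w, ⟨hw, hh⟩, hw0⟩ := Submodule.exists_mem_ne_zero_of_ne_bot hne
  obtain ⟨β, hβ⟩ := Finsupp.ne_iff.1 hw0
  rw [Finsupp.zero_apply] at hβ
  obtain ⟨h1, h2⟩ := mem_homogeneous.1 hh β hβ
  have hc := mem_rootCone_of_mem_principalSubspace hw hβ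
  obtain ⟨s, hs⟩ := MvPolynomial.ne_zero_iff.1 hβ
  have h3 := mem_fockWeight_iff_coeff.1 h2 s hs
  obtain ⟨a, ha⟩ := exists_nat_half_form_self hc
  choose n hn using exists_nat_form_fundWeight hc
  have h4 : ((monWeight s : ℤ) : ℚ) = e.2 - a := by rw [← ha]; exact_mod_cast h3
  obtain ⟨b, hb⟩ := Int.eq_ofNat_of_zero_le (monWeight_nonneg s)
  refine ⟨Finsupp.equivFunOnFinite.symm fun v => v.elim (b + a) n, ?_⟩
  refine Prod.ext (funext fun i => ?_) ?_
  · simp [exponents, ← h1 i, hn]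
  · rw [hb] at h4
    simp only [exponents, Finsupp.equivFunOnFinite_symm_apply_apply, Option.elim]
    push_cast at h4 ⊢
    linarith

theorem toFormal_exponents (F : CharRing l) (n : Option (Fin l) →₀ ℕ) :
    toFormal F (exponents n) = MvPowerSeries.coeff n F :=
  exponents_injective.extend_apply _ _ _

theorem toFormal_of_notMem_range (F : CharRing l) {e : (Fin l → ℚ) × ℚ}
    (he : e ∉ Set.range (exponents (l := l))) : toFormal F e = 0 :=
  Function.extend_apply' _ _ _ he

/-- The graded dimension of `W(Λ_0)`, as a power series. -/
noncomputable def charSeries (ε : Cocycle l) : CharRing l := fun n => gradedDim ε 0 (exponents n)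

theorem coeff_charSeries (ε : Cocycle l) (n : Option (Fin l) →₀ ℕ) :
    MvPowerSeries.coeff n (charSeries ε) = gradedDim ε 0 (exponents n) := rfl

theorem toFormal_charSeries (ε : Cocycle l) : toFormal (charSeries ε) = gradedDim ε 0 := by
  funext e
  by_cases he : e ∈ Set.range (exponents (l := l))
  · obtain ⟨n, rfl⟩ := he
    rw [toFormal_exponents, coeff_charSeries]
  · rw [toFormal_of_notMem_range _ he]
    by_contra h
    exact he (mem_range_exponents_of_gradedDim_ne_zero (Ne.symm h))

theorem prod_shiftVar_pow (j : Fin l) (d : Option (Fin l) →₀ ℕ) :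
    (d.prod fun v e => shiftVar j v ^ e) =
      MvPowerSeries.monomial (d + Finsupp.single none (d (some j))) (1 : ℂ) := by
  have h : ∀ v, shiftVar j v = MvPowerSeries.monomial
      (Finsupp.single v 1 + if v = some j then Finsupp.single none 1 else 0) (1 : ℂ) := by
    rintro (_ | i)
    · simp [shiftVar, MvPowerSeries.X]
    · by_cases hi : i = j
      · simp [shiftVar, hi, MvPowerSeries.X, MvPowerSeries.monomial_mul_monomial]
      · simp [shiftVar, hi, MvPowerSeries.X]
  induction d using Finsupp.induction_linear with
  | zero => simp
  | add f g hf hg =>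
    rw [Finsupp.prod_add_index' (by simp) (by intros; rw [pow_add]), hf, hg,
      MvPowerSeries.monomial_mul_monomial, one_mul, Finsupp.add_apply, Finsupp.single_add,
      add_add_add_comm]
  | single v e =>
    rw [Finsupp.prod_single_index (h := fun v e => shiftVar j v ^ e) (pow_zero _), h,
      MvPowerSeries.monomial_pow, one_pow, smul_add]
    congr 2
    by_cases hv : v = some j <;> simp [hv]

/-- Substituting `x_j q` for `x_j` moves the monomial with exponents `(r, k)` to
`(r, k + r_j)`. -/
theorem toFormal_substShift (j : Fin l) (F : CharRing l) (e : (Fin l → ℚ) × ℚ) :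
    toFormal (substShift j F) e = toFormal F (e.1, e.2 - e.1 j) := by
  classical
  set S : (Option (Fin l) →₀ ℕ) → Option (Fin l) →₀ ℕ :=
    fun d => d + Finsupp.single none (d (some j)) with hS
  have hexp : ∀ d, exponents (S d) = ((exponents d).1, (exponents d).2 + (exponents d).1 j) := by
    intro d
    simp [exponents, hS]
  have hcoeff : ∀ n d, MvPowerSeries.coeff d F •
      MvPowerSeries.coeff n (d.prod fun v e => shiftVar j v ^ e) =
        if n = S d then MvPowerSeries.coeff d F else 0 := by
    intro n d
    rw [prod_shiftVar_pow, MvPowerSeries.coeff_monomial, smul_ite, smul_zero, smul_eq_mul,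
      mul_one]
  by_cases he : ∃ d, exponents d = (e.1, e.2 - e.1 j)
  · obtain ⟨d, hd⟩ := he
    have hed : e = exponents (S d) := by
      rw [hexp, hd, sub_add_cancel]
    rw [← hd, toFormal_exponents]
    rw [hed, toFormal_exponents, substShift, MvPowerSeries.coeff_subst (shiftVar_hasSubst j)]
    simp only [hcoeff]
    have hinj : ∀ d', S d = S d' ↔ d' = d := by
      intro d'
      refine ⟨fun h => exponents_injective ?_, fun h => by rw [h]⟩
      have h2 := congrArg exponents h
      rw [hexp, hexp, Prod.mk.injEq] at h2
      refine Prod.ext h2.1.symm ?_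
      have h3 := h2.2
      rw [h2.1] at h3
      exact (add_right_cancel h3).symm
    simp only [hinj]
    rw [finsum_eq_single _ d fun d' h => if_neg h, if_pos rfl]
  · rw [toFormal_of_notMem_range F (by simpa using he)]
    by_cases hn : e ∈ Set.range (exponents (l := l))
    · obtain ⟨n, rfl⟩ := hn
      rw [toFormal_exponents, substShift, MvPowerSeries.coeff_subst (shiftVar_hasSubst j)]
      simp only [hcoeff]
      refine finsum_eq_zero_of_forall_eq_zero fun d => if_neg fun h => he ⟨d, ?_⟩
      rw [h, hexp, add_sub_cancel_right]
    · exact toFormal_of_notMem_range _ hn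

theorem normGradedDim_apply (ε : Cocycle l) (j : Fin l) (e : (Fin l → ℚ) × ℚ) :
    normGradedDim ε j e = gradedDim ε 0 (e.1, e.2 - e.1 j) := by
  have h := map_latticeOp_fundWeight_homPart ε j e.1 (e.2 - e.1 j)
  have hr := LinearEquiv.finrank_eq (Submodule.equivMapOfInjective
    (latticeOp (fundWeight j)) (latticeOp_injective _) (homPart ε 0 e.1 (e.2 - e.1 j)))
  rw [h, sub_add_cancel] at hr
  have hs : (e.1 - fun i => -form (fundWeight i) (fundWeight j)) =
      fun i => e.1 i + form (fundWeight i) (fundWeight j) :=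
    funext fun i => sub_neg_eq_add _ _
  rw [normGradedDim, mulMonomial, hs, sub_neg_eq_add, gradedDim, gradedDim, hr]

end PrincipalSubspace

open PrincipalSubspace in
theorem mainTheorem6 (l : ℕ) (ε : Cocycle l) (j : Fin l) :
    (∃ Φ : principalSubspace ε 0 ≃ₗ[ℂ] principalSubspace ε (fundWeight j),
      (∀ w : principalSubspace ε 0,
        (Φ w : LatticeSpace l) = latticeOp (fundWeight j) (w : LatticeSpace l)) ∧
      ∀ (r : Fin l → ℚ) (k : ℚ),
        (homPart ε 0 r k).map (latticeOp (fundWeight j)) =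
          homPart ε (fundWeight j) (fun i => r i + form (fundWeight i) (fundWeight j))
            (k + r j + form (fundWeight j) (fundWeight j) / 2)) ∧
    (∀ μ : Weight l, (μ = 0 ∨ μ = fundWeight j) →
      (⨆ (r : Fin l → ℚ) (k : ℚ), homPart ε μ r k) = principalSubspace ε μ ∧
      ∀ (r : Fin l → ℚ) (k : ℚ), FiniteDimensional ℂ (homPart ε μ r k)) ∧
    ∃ F : CharRing l, toFormal F = gradedDim ε 0 ∧
      toFormal (substShift j F) = normGradedDim ε j := by
  refine ⟨⟨(Submodule.equivMapOfInjective (latticeOp (fundWeight j)) (latticeOp_injective _)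
    (principalSubspace ε 0)).trans
      (LinearEquiv.ofEq _ _ (map_latticeOp_principalSubspace ε (fundWeight j))),
    fun w => rfl, map_latticeOp_fundWeight_homPart ε j⟩,
    fun μ _ => ⟨iSup_homPart ε μ, fun r k => inferInstance⟩,
    charSeries ε, toFormal_charSeries ε, ?_⟩
  funext e
  rw [toFormal_substShift, toFormal_charSeries, normGradedDim_apply]
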